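/- Let $K$ be a global function field of odd characteristic, i.e. a finite extension of $\mathbb{F}_q(t)$ with $q$ odd. Let $X$ be the set of places (classes of discrete valuations) of $K$, identified with the closed points of its smooth complete curve. For $\mathfrak{p}\in X$ let $\operatorname{ord}_{\mathfrak{p}}$ be the normalized valuation and $K_{\mathfrak{p}}$ the completion, and for $\lambda\in K^\times$ (or its square class) let $\left(\frac{\lambda}{\mathfrak{p}}\right)$ be $1$ if $\lambda$ is a square in $K_{\mathfrak{p}}$, $0$ if $\operatorname{ord}_{\mathfrak{p}}\lambda$ is odd, and $-1$ otherwise. Let $\operatorname{Pic}X$ be the group of divisors modulo principal divisors; places are called linearly independent in $\operatorname{Pic}X/2\operatorname{Pic}X$ if the family of cosets of their classes is linearly independent over $\mathbb{F}_2$. For $\mathfrak{S}\subseteq X$, an element $\lambda\in K^\times$ is $\mathfrak{S}$-singular if $\operatorname{ord}_{\mathfrak{p}}\lambda$ is even for all $\mathfrak{p}\in X\setminus\mathfrak{S}$; let $\operatorname{Sing}(\mathfrak{S})\subseteq K^\times/(K^\times)^2$ be the $\mathbb{F}_2$-vector space of square classes of $\mathfrak{S}$-singular elements. Let $\mathscr{B}=\{\beta_1,\dots,\beta_n\}$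 be a basis of $\operatorname{Sing}(\emptyset)$ and $\mathfrak{B}=\{\mathfrak{b}_1,\dots,\mathfrak{b}_n\}\subset X$ a set of places compatible with it, i.e. $\left(\frac{\beta_i}{\mathfrak{b}_i}\right)=-1$ and $\left(\frac{\beta_i}{\mathfrak{b}_j}\right)=1$ for all $i\neq j$. Let $\mathfrak{S}\subset X$ be a finite set disjoint from $\mathfrak{B}$, and let $\mathfrak{S}'\subseteq\mathfrak{S}$ be a maximal subset of $\mathfrak{S}$ that is linearly independent in $\operatorname{Pic}X/2\operatorname{Pic}X$. Then: 1. For every $\mathfrak{p}\in\mathfrak{S}\setminus\mathfrak{S}'$ there is an $(\mathfrak{S}'\cup\{\mathfrak{p}\})$-singular element $\lambda_{\mathfrak{p}}\in K^\times$ such that $\operatorname{ord}_{\mathfrak{p}}\lambda_{\mathfrak{p}}$ is odd and $\left(\frac{\lambda_{\mathfrak{p}}}{\mathfrak{b}}\right)=1$ for every $\mathfrak{b}\in\mathfrak{B}$. 2. For every choice of elements $\lambda_{\mathfrak{p}}$ ($\mathfrak{p}\in\mathfrak{S}\setminus\mathfrak{S}'$) as in (1), the square classes $\beta_1,\dots,\beta_n$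 together with those of the $\lambda_{\mathfrak{p}}$ form, without repetition, a basis of the $\mathbb{F}_2$-vector space $\operatorname{Sing}(\mathfrak{S})$. -/

import Mathlib

noncomputable section

namespace SSingular

/-! ### Places, valuations, local squares -/

/-- The places of a field `K`: the (equivalence classes of) discrete valuations on `K`, each
represented by its valuation ring, a discrete valuation ring with field of fractions `K`. For a
global function field these are the closed points of its smooth complete curve. -/
abbrev Place (K : Type*) [Field K] : Type _ :=
  {A : ValuationSubring K // IsDiscreteValuationRing A}

instance {K : Type*} [Field K] (𝔭 : Place K) : IsDiscreteValuationRing 𝔭.1 := 𝔭.2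

section Places

variable {K : Type*} [Field K]

/-- The maximal ideal of the valuation ring of a place. -/
def Place.maxIdeal (𝔭 : Place K) : IsDedekindDomain.HeightOneSpectrum 𝔭.1 :=
  IsDiscreteValuationRing.maximalIdeal 𝔭.1

/-- The completion `K_𝔭` of `K` at the place `𝔭`. -/
abbrev Place.completion (𝔭 : Place K) : Type _ := 𝔭.maxIdeal.adicCompletion K

/-- The normalized (surjective) additive valuation `ord_𝔭` on `Kˣ`. -/
def Place.ord (𝔭 : Place K) (f : Kˣ) : ℤ := -WithZero.log (𝔭.maxIdeal.valuation K (f : K))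

/-- `f` is a square in the completion `K_𝔭`. -/
def Place.IsLocalSquare (𝔭 : Place K) (f : Kˣ) : Prop :=
  IsSquare (algebraMap K 𝔭.completion (f : K))

theorem Place.ord_mul (𝔭 : Place K) (f g : Kˣ) : 𝔭.ord (f * g) = 𝔭.ord f + 𝔭.ord g := by
  have hf : 𝔭.maxIdeal.valuation K (f : K) ≠ 0 := by simp
  have hg : 𝔭.maxIdeal.valuation K (g : K) ≠ 0 := by simp
  simp only [Place.ord, Units.val_mul, map_mul, WithZero.log_mul hf hg]
  ring

theorem Place.ord_one (𝔭 : Place K) : 𝔭.ord (1 : Kˣ) = 0 := by simp [Place.ord]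

theorem Place.ord_inv (𝔭 : Place K) (f : Kˣ) : 𝔭.ord f⁻¹ = -𝔭.ord f := by
  have h := 𝔭.ord_mul f f⁻¹
  rw [mul_inv_cancel, 𝔭.ord_one] at h
  omega

open Classical in
/-- The Legendre symbol of `f ∈ Kˣ` at `𝔭`: it is `0` if `ord_𝔭 f` is odd, and otherwise `1` or
`-1` according to whether `f` is a square in `K_𝔭` or not. -/
def Place.legendre (𝔭 : Place K) (f : Kˣ) : ℤ :=
  if 𝔭.IsLocalSquare f then 1 else if Odd (𝔭.ord f) then 0 else -1

theorem Place.legendre_mul_self (𝔭 : Place K) (f g : Kˣ) :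
    𝔭.legendre (f * (g * g)) = 𝔭.legendre f := by
  have h1 : 𝔭.IsLocalSquare (f * (g * g)) ↔ 𝔭.IsLocalSquare f := by
    have hg : algebraMap K 𝔭.completion (g : K) ≠ 0 := by simp
    simp only [Place.IsLocalSquare, Units.val_mul, map_mul]
    constructor
    · rintro ⟨r, hr⟩
      refine ⟨r / algebraMap K 𝔭.completion (g : K), ?_⟩
      field_simp
      rw [pow_two, pow_two, hr]
    · rintro ⟨r, hr⟩
      exact ⟨r * algebraMap K 𝔭.completion (g : K), by rw [hr]; ring⟩
  have h2 : Odd (𝔭.ord (f * (g * g))) ↔ Odd (𝔭.ord f) := by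
    rw [𝔭.ord_mul, 𝔭.ord_mul]
    exact Int.odd_add.trans (by simp)
  simp only [Place.legendre]
  split_ifs <;> tauto

end Places

/-! ### Reduction modulo 2 of an abelian group -/

section ModTwo

/-- `G / 2G` for an abelian group `G`. -/
abbrev ModTwo (G : Type*) [AddCommGroup G] : Type _ :=
  G ⧸ (zsmulAddGroupHom (2 : ℤ) : G →+ G).range

instance (G : Type*) [AddCommGroup G] : Module (ZMod 2) (ModTwo G) :=
  QuotientAddGroup.zmodModule fun x => ⟨x, by simp [two_zsmul, two_nsmul]⟩

/-- The projection `G → G / 2G`. -/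
abbrev ModTwo.mk {G : Type*} [AddCommGroup G] : G →+ ModTwo G := QuotientAddGroup.mk' _

/-- The family `v` is a basis of the subspace `W`. -/
def IsBasisOf {F V ι : Type*} [Field F] [AddCommGroup V] [Module F V] (v : ι → V)
    (W : Submodule F V) : Prop :=
  LinearIndependent F v ∧ Submodule.span F (Set.range v) = W

end ModTwo

/-! ### Divisors and the Picard group -/

section Picard

variable (K : Type*) [Field K]

/-- The divisor group: the free abelian group on the places. -/
abbrev Divisor : Type _ := Place K →₀ ℤ

/-- The subgroup of principal divisors, i.e. of the divisors `∑ ord_𝔭(f) 𝔭` for `f ∈ Kˣ`. -/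
def principalDivisors : AddSubgroup (Divisor K) where
  carrier := {D | ∃ f : Kˣ, ∀ 𝔭 : Place K, D 𝔭 = 𝔭.ord f}
  zero_mem' := ⟨1, fun 𝔭 => by simp [𝔭.ord_one]⟩
  add_mem' := by
    rintro D E ⟨f, hf⟩ ⟨g, hg⟩
    exact ⟨f * g, fun 𝔭 => by simp [hf 𝔭, hg 𝔭, 𝔭.ord_mul]⟩
  neg_mem' := by
    rintro D ⟨f, hf⟩
    exact ⟨f⁻¹, fun 𝔭 => by simp [hf 𝔭, 𝔭.ord_inv]⟩

/-- The Picard group: divisors modulo principal divisors. -/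
abbrev Pic : Type _ := Divisor K ⧸ principalDivisors K

variable {K}

/-- The coset modulo `2 Pic` of the class of the place `𝔭` (as a prime divisor). -/
def Place.picClass (𝔭 : Place K) : ModTwo (Pic K) :=
  ModTwo.mk (QuotientAddGroup.mk' (principalDivisors K) (Finsupp.single 𝔭 1))

end Picard

/-! ### Square classes and singular elements -/

section Singular

variable (K : Type*) [Field K]

/-- The square class group `Kˣ / (Kˣ)²`, written additively, a vector space over `𝔽₂`. -/
abbrev SquareClass : Type _ := ModTwo (Additive Kˣ)

variable {K}

/-- The square class of `f`. -/
def sqClass (f : Kˣ) : SquareClass K := ModTwo.mk (Additive.ofMul f)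

/-- The Legendre symbol at `𝔭` as a function on square classes. -/
def Place.legendreClass (𝔭 : Place K) (x : SquareClass K) : ℤ :=
  Quotient.liftOn' x (fun f => 𝔭.legendre f.toMul) (by
    intro f g h
    rw [QuotientAddGroup.leftRel_apply] at h
    obtain ⟨c, hc⟩ := h
    have hg : g.toMul = f.toMul * (c.toMul * c.toMul) := by
      have : g = f + (c + c) := by
        rw [← two_zsmul]
        exact (eq_add_of_neg_add_eq hc.symm)
      rw [this]; rfl
    change 𝔭.legendre f.toMul = 𝔭.legendre g.toMul
    rw [hg, 𝔭.legendre_mul_self])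

theorem Place.legendreClass_sqClass (𝔭 : Place K) (f : Kˣ) :
    𝔭.legendreClass (sqClass f) = 𝔭.legendre f := rfl

/-- `f` is `𝔖`-singular: it has even valuation at every place outside `𝔖`. -/
def IsSingular (𝔖 : Set (Place K)) (f : Kˣ) : Prop :=
  ∀ 𝔭 : Place K, 𝔭 ∉ 𝔖 → Even (𝔭.ord f)

/-- The group of `𝔖`-singular elements of `Kˣ`. -/
def singularSubgroup (𝔖 : Set (Place K)) : Subgroup Kˣ where
  carrier := {f | IsSingular 𝔖 f}
  one_mem' := fun 𝔭 _ => by simp [𝔭.ord_one]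
  mul_mem' := fun hf hg 𝔭 h𝔭 => by
    rw [𝔭.ord_mul]
    exact (hf 𝔭 h𝔭).add (hg 𝔭 h𝔭)
  inv_mem' := fun hf 𝔭 h𝔭 => by
    rw [𝔭.ord_inv]
    exact (hf 𝔭 h𝔭).neg

/-- The group of `𝔖`-singular elements modulo squares, as a subspace of `Kˣ / (Kˣ)²`. -/
def Sing (𝔖 : Set (Place K)) : Submodule (ZMod 2) (SquareClass K) :=
  AddSubgroup.toZModSubmodule 2 ((Subgroup.toAddSubgroup (singularSubgroup 𝔖)).map ModTwo.mk)

theorem mem_Sing {𝔖 : Set (Place K)} {x : SquareClass K} :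
    x ∈ Sing 𝔖 ↔ ∃ f : Kˣ, IsSingular 𝔖 f ∧ sqClass f = x := Iff.rfl

/-- The square classes `β₁, …, βₙ` and the places `𝔟₁, …, 𝔟ₙ` are compatible: `βᵢ` is a
local square at every `𝔟ⱼ` with `j ≠ i`, and has Legendre symbol `-1` at `𝔟ᵢ`. -/
def Compatible {n : ℕ} (β : Fin n → SquareClass K) (𝔟 : Fin n → Place K) : Prop :=
  ∀ i j : Fin n, (𝔟 j).legendreClass (β i) = if i = j then -1 else 1

/-- `𝔖'` is a maximal subset of `𝔖` whose places are linearly independent in `Pic / 2 Pic`. -/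
def IsMaximalIndependent (𝔖' 𝔖 : Set (Place K)) : Prop :=
  Maximal (fun T : Set (Place K) => T ⊆ 𝔖 ∧
    LinearIndependent (ZMod 2) (fun 𝔭 : T => (𝔭 : Place K).picClass)) 𝔖'

/-- `f` is an element attached to the place `𝔭`: it is `(𝔖' ∪ {𝔭})`-singular, has odd valuation
at `𝔭`, and has Legendre symbol `1` at each `𝔟ᵢ`. -/
def IsLambda {n : ℕ} (𝔟 : Fin n → Place K) (𝔖' : Set (Place K)) (𝔭 : Place K) (f : Kˣ) : Prop :=
  IsSingular (𝔖' ∪ {𝔭}) f ∧ Odd (𝔭.ord f) ∧ ∀ i, (𝔟 i).legendre f = 1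

end Singular

end SSingular

end

open SSingular

/-! The parities of `𝔭.ord` are linear functionals on square classes, and `Sing 𝔖` is the common
kernel of those outside `𝔖`. For 𝔭 in `𝔖 \ 𝔖'`, maximality makes the class of 𝔭 in Pic/2Pic a
combination of classes from `𝔖'`; this relation is realised by a function with odd order at 𝔭 and
even order outside `𝔖' ∪ {𝔭}` (`exists_isSingular_odd`). Multiplying by suitable βᵢ repairs the
symbols: βᵢ affects only the one at 𝔟ᵢ, and two local non-squares of even order multiply to a local
square (`Place.isLocalSquare_mul`: Hensel's lemma plus the same fact in the residue field, which is
algebraic over a finite field).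

For the basis, the parities at `𝔖 \ 𝔖'` vanish on `Sing ∅` and are dual to the λ's, which gives
independence. Removing the λ-component of a class in `Sing 𝔖` leaves one in `Sing 𝔖'`, and
independence of `𝔖'` in Pic/2Pic forces that into `Sing ∅` (`Sing_le_Sing_empty`). The last step
needs functions to have divisors, i.e. finitely many zeros; a transcendental f has at most [K :
F(f)] of them. -/

noncomputable section

namespace SSingular

open WithZero

/-! ### Squares in complete fields and in algebraic extensions of finite fields -/

/-- In a complete field with a discrete valuation for which `2` is a unit, every principal unit
is a square. -/
theorem isSquare_one_add_of_valued_lt_one {L : Type*} [Field L] [Valued L ℤᵐ⁰] [CompleteSpace L]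
    [T2Space L] (h2 : Valued.v (2 : L) = 1) {c : L} (hc : Valued.v c < 1) : IsSquare (1 + c) := by
  have h2' : (2 : L) ≠ 0 := by
    intro h
    simp [h] at h2
  set v : Valuation L ℤᵐ⁰ := Valued.v with hv
  -- A fixed point z satisfies (1 + z)² = 1 + c, and Φ is contracting on the ball of radius `v c`.
  let Φ : L → L := fun y => (c - y ^ 2) / 2
  let y : ℕ → L := fun n => Φ^[n] 0
  have hstep : ∀ n, y (n + 1) = (c - y n ^ 2) / 2 := fun n => Function.iterate_succ_apply' Φ n 0
  have hdiv : ∀ x : L, v (x / 2) = v x := fun x => by rw [map_div₀, h2, div_one]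
  have hle : ∀ n, v (y n) ≤ v c := by
    intro n
    induction n with
    | zero => simp [y]
    | succ n ih =>
      rw [hstep, hdiv]
      refine (v.map_sub _ _).trans (max_le le_rfl ?_)
      rw [map_pow, sq]
      exact (mul_le_mul' ih (ih.trans hc.le)).trans (mul_one _).le
  have hdiff : ∀ n, v (y (n + 1) - y n) ≤ v c ^ (n + 1) := by
    intro n
    induction n with
    | zero => simpa [y] using hle 1
    | succ n ih =>
      have : y (n + 1 + 1) - y (n + 1) = (y n + y (n + 1)) * -(y (n + 1) - y n) / 2 := by
        rw [hstep (n + 1)]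
        nth_rw 2 [hstep n]
        ring
      rw [this, hdiv, map_mul, Valuation.map_neg, pow_succ']
      exact mul_le_mul' ((v.map_add _ _).trans (max_le (hle _) (hle _))) ih
  have hcauchy : CauchySeq y := by
    have : NonarchimedeanRing L := 
      (Valued.toUniformSpace_eq L ℤᵐ⁰).symm ▸ v.subgroups_basis.nonarchimedean
    apply NonarchimedeanAddGroup.cauchySeq_of_tendsto_sub_nhds_zero
    rw [(Valued.hasBasis_nhds_zero L ℤᵐ⁰).tendsto_right_iff]
    rintro γ -
    let γ' : ℤᵐ⁰ˣ := Units.map (MonoidWithZeroHom.ValueGroup₀.embedding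
      (f := MonoidWithZeroHom.ofClass v)).toMonoidHom γ
    obtain ⟨N, hN⟩ := exists_pow_lt₀ hc γ'
    filter_upwards [Filter.eventually_ge_atTop N] with n hn
    have h1 : v (y (n + 1) - y n) < γ' :=
      (hdiff n).trans_lt ((pow_le_pow_right_of_le_one' hc.le (by omega)).trans_lt hN)
    exact Valuation.restrict_lt_iff_lt_embedding _ |>.mpr h1
  obtain ⟨z, hz⟩ := cauchySeq_tendsto_of_complete hcauchy
  have hz1 : Filter.Tendsto (fun n => y (n + 1)) Filter.atTop (nhds z) :=
    hz.comp (Filter.tendsto_add_atTop_nat 1)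
  have hz2 : Filter.Tendsto (fun n => (c - y n ^ 2) / 2) Filter.atTop (nhds ((c - z ^ 2) / 2)) :=
    (tendsto_const_nhds.sub (hz.pow 2)).div_const 2
  have hfix : z = (c - z ^ 2) / 2 := by
    refine tendsto_nhds_unique hz1 ?_
    simpa only [hstep] using hz2
  refine ⟨1 + z, ?_⟩
  rw [eq_div_iff h2'] at hfix
  linear_combination -hfix

/-- In an algebraic extension of a finite field, a product of two non-squares is a square. -/
theorem isSquare_mul_of_not_isSquare {F κ : Type*} [Field F] [Finite F] [Field κ] [Algebra F κ]
    [Algebra.IsAlgebraic F κ] {a b : κ} (ha : ¬ IsSquare a) (hb : ¬ IsSquare b) :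
    IsSquare (a * b) := by
  classical
  -- This subfield is finite, so its quadratic character is available.
  let E : IntermediateField F κ := IntermediateField.adjoin F {a, b}
  have : FiniteDimensional F E :=
    IntermediateField.finiteDimensional_adjoin fun x _ => Algebra.IsIntegral.isIntegral x
  have : Finite E := Module.finite_of_finite F
  have := Fintype.ofFinite E
  have hmap : ∀ x : E, IsSquare x → IsSquare (x : κ) := fun x hx => hx.map E.val
  let a' : E := ⟨a, IntermediateField.subset_adjoin _ _ (by simp)⟩
  let b' : E := ⟨b, IntermediateField.subset_adjoin _ _ (by simp)⟩
  have ha' : ¬ IsSquare a' := fun h => ha (hmap _ h)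
  have hb' : ¬ IsSquare b' := fun h => hb (hmap _ h)
  refine hmap (a' * b') ?_
  have hE : ringChar E ≠ 2 := fun h => ha' (FiniteField.isSquare_of_char_two h a')
  have h0 : a' * b' ≠ 0 := by
    refine mul_ne_zero ?_ ?_ <;> rintro h <;> simp [h] at ha' hb'
  rw [← quadraticChar_one_iff_isSquare h0, map_mul,
    quadraticChar_neg_one_iff_not_isSquare.mpr ha', quadraticChar_neg_one_iff_not_isSquare.mpr hb']
  norm_num

end SSingular
end

/-! ### Function fields: transcendence degree and residue fields -/

noncomputable section

namespace SSingular

open Algebra IntermediateField IntermediateField.algebraAdjoinAdjoin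

section FunctionFieldBasics

variable {F K : Type*} [Field F] [Field K]

theorem trdeg_eq_one_of_finite_ratFunc [Algebra F K] [Algebra (RatFunc F) K]
    [IsScalarTower F (RatFunc F) K] [FiniteDimensional (RatFunc F) K] : Algebra.trdeg F K = 1 := by
  have h := lift_trdeg_add_eq F (RatFunc F) K
  have h' := trdeg_add_eq F (Polynomial F) (A := RatFunc F)
  have : Algebra.IsAlgebraic (Polynomial F) (RatFunc F) :=
    IsLocalization.isAlgebraic _ (nonZeroDivisors (Polynomial F))
  rw [Polynomial.trdeg_of_isDomain, trdeg_eq_zero, add_zero] at h'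
  rw [← h', trdeg_eq_zero] at h
  simpa using h.symm

theorem essFiniteType_of_finite_ratFunc [Algebra F K] [Algebra (RatFunc F) K]
    [IsScalarTower F (RatFunc F) K] [FiniteDimensional (RatFunc F) K] :
    Algebra.EssFiniteType F K := by
  have : Algebra.EssFiniteType (Polynomial F) (RatFunc F) :=
    .of_isLocalization _ (nonZeroDivisors (Polynomial F))
  have : Algebra.EssFiniteType F (RatFunc F) := .comp F (Polynomial F) (RatFunc F)
  exact .comp F (RatFunc F) K

variable [Algebra F K]

/-- In a field of transcendence degree one everything is algebraic over `F(f)`, for `f`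
transcendental. -/
theorem isAlgebraic_adjoin_of_transcendental (h : Algebra.trdeg F K = 1) {f : K}
    (hf : Transcendental F f) : Algebra.IsAlgebraic F⟮f⟯ K := by
  have h1 : AlgebraicIndependent F (fun _ : Unit => f) :=
    algebraicIndependent_unique_type_iff.mpr hf
  have h2 := h1.isTranscendenceBasis_of_lift_trdeg_le_of_finite (by simp [h])
  have h3 := h2.isAlgebraic_field
  rwa [Set.range_const] at h3

theorem finiteDimensional_adjoin_of_transcendental [Algebra.EssFiniteType F K]
    (h : Algebra.trdeg F K = 1) {f : K} (hf : Transcendental F f) : FiniteDimensional F⟮f⟯ K := by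
  have := isAlgebraic_adjoin_of_transcendental h hf
  have : Algebra.EssFiniteType F⟮f⟯ K := .of_comp F F⟮f⟯ K
  exact Algebra.finite_of_essFiniteType_of_isAlgebraic

/-- A valuation ring contains every finite subfield. -/
theorem algebraMap_mem_of_finite [Finite F] (A : ValuationSubring K) (c : F) :
    algebraMap F K c ∈ A := by
  rcases eq_or_ne c 0 with rfl | hc
  · simp
  have := Fintype.ofFinite F
  have h1 : IsIntegral A (algebraMap F K c) := by
    refine IsIntegral.of_pow (n := Fintype.card F - 1)
      (Nat.sub_pos_of_lt Fintype.one_lt_card) ?_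
    rw [← map_pow, FiniteField.pow_card_sub_one_eq_one c hc, map_one]
    exact isIntegral_one
  obtain ⟨y, hy⟩ := IsIntegrallyClosed.isIntegral_iff.mp h1
  rw [← hy]
  exact y.2

/-- The residue field of a proper valuation ring of a function field is algebraic over the
constants. -/
theorem isAlgebraic_residue (h : Algebra.trdeg F K = 1) (A : ValuationSubring K) (hA : A ≠ ⊤)
    [Algebra F A] [IsScalarTower F A K] :
    Algebra.IsAlgebraic F (IsLocalRing.ResidueField A) := by
  refine ⟨fun x => ?_⟩
  obtain ⟨a, rfl⟩ := IsLocalRing.residue_surjective x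
  by_contra hx
  -- If the residue of a were transcendental, F(a) would lie in A; K is algebraic over F(a) and A is
  -- integrally closed, so A would be all of K.
  have hunit : ∀ p : Polynomial F, p ≠ 0 → IsUnit (Polynomial.aeval a p) := by
    intro p hp
    rw [← IsLocalRing.residue_ne_zero_iff_isUnit]
    intro h0
    refine hx ⟨p, hp, ?_⟩
    rw [← IsLocalRing.ResidueField.algebraMap_eq, Polynomial.aeval_algebraMap_apply,
      IsLocalRing.ResidueField.algebraMap_eq, h0]
  have haK : ∀ p : Polynomial F, Polynomial.aeval (a : K) p = (Polynomial.aeval a p : A) :=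
    fun p => Polynomial.aeval_algebraMap_apply K a p
  have htr : Transcendental F (a : K) := by
    rintro ⟨p, hp, hp0⟩
    rw [haK] at hp0
    have := hunit p hp
    rw [Subtype.ext (a1 := Polynomial.aeval a p) (a2 := 0) hp0] at this
    exact not_isUnit_zero this
  have halg := isAlgebraic_adjoin_of_transcendental h htr
  have hsub : ∀ y ∈ F⟮(a : K)⟯, y ∈ A := by
    intro y hy
    obtain ⟨p, q, rfl⟩ := (mem_adjoin_simple_iff F y).mp hy
    rcases eq_or_ne q 0 with rfl | hq
    · simp
    obtain ⟨u, hu⟩ := hunit q hq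
    have : (Polynomial.aeval (a : K) q)⁻¹ = ((u⁻¹ : Aˣ) : A) := by
      rw [haK, ← hu]
      exact inv_eq_of_mul_eq_one_right (congrArg Subtype.val u.mul_inv)
    rw [div_eq_mul_inv, this, haK]
    exact A.mul_mem _ _ (SetLike.coe_mem _) (SetLike.coe_mem _)
  refine hA (eq_top_iff.mpr fun y _ => ?_)
  let φ : F⟮(a : K)⟯ →+* A := (F⟮(a : K)⟯.val : F⟮(a : K)⟯ →+* K).codRestrict A.toSubring
    fun z => hsub z z.2
  have h1 : IsIntegral A y := by
    obtain ⟨p, hp, hp0⟩ := (Algebra.IsIntegral.isIntegral (R := F⟮(a : K)⟯) y)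
    refine ⟨p.map φ, hp.map φ, ?_⟩
    rw [Polynomial.eval₂_map]
    exact hp0
  obtain ⟨z, rfl⟩ := IsIntegrallyClosed.isIntegral_iff.mp h1
  exact z.2

end FunctionFieldBasics

end SSingular
end

/-! ### Local squares at a place -/

noncomputable section

namespace SSingular

open WithZero IsDedekindDomain

section LocalSquares

variable {F K : Type*} [Field F] [Field K] (𝔭 : Place K)

theorem Place.valuation_eq_exp (f : Kˣ) : 𝔭.maxIdeal.valuation K (f : K) = exp (-𝔭.ord f) := by
  rw [Place.ord, neg_neg, exp_log (by simp)]

theorem Place.valuation_le_one_iff (x : K) : 𝔭.maxIdeal.valuation K x ≤ 1 ↔ x ∈ 𝔭.1 := by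
  constructor
  · intro h
    obtain ⟨a, rfl⟩ := IsDiscreteValuationRing.exists_lift_of_le_one h
    exact a.2
  · intro h
    exact 𝔭.maxIdeal.valuation_le_one (⟨x, h⟩ : 𝔭.1)

theorem Place.exists_ord_eq (n : ℤ) : ∃ f : Kˣ, 𝔭.ord f = n := by
  obtain ⟨x, hx⟩ := 𝔭.maxIdeal.valuation_surjective K (exp (-n))
  have hx0 : x ≠ 0 := by
    rintro rfl
    rw [map_zero] at hx
    exact exp_ne_zero hx.symm
  refine ⟨Units.mk0 x hx0, ?_⟩
  rw [Place.ord, Units.val_mk0, hx, log_exp, neg_neg]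

theorem Place.ne_top : 𝔭.1 ≠ ⊤ := by
  intro h
  obtain ⟨f, hf⟩ := 𝔭.exists_ord_eq (-1)
  have h1 := (𝔭.valuation_le_one_iff (f : K)).mpr (h ▸ ValuationSubring.mem_top _)
  rw [𝔭.valuation_eq_exp, hf, ← exp_zero, exp_le_exp] at h1
  omega

theorem Place.legendre_eq_one_iff (f : Kˣ) : 𝔭.legendre f = 1 ↔ 𝔭.IsLocalSquare f := by
  unfold Place.legendre
  split_ifs <;> simp_all

theorem Place.legendre_eq_neg_one_iff (f : Kˣ) :
    𝔭.legendre f = -1 ↔ ¬ 𝔭.IsLocalSquare f ∧ Even (𝔭.ord f) := by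
  unfold Place.legendre
  split_ifs <;> simp_all

theorem Place.valuation_algebraMap_of_finite [Algebra F K] [Finite F] {c : F} (hc : c ≠ 0) :
    𝔭.maxIdeal.valuation K (algebraMap F K c) = 1 := by
  refine le_antisymm ((𝔭.valuation_le_one_iff _).mpr (algebraMap_mem_of_finite _ c)) ?_
  have h := (𝔭.valuation_le_one_iff _).mpr (algebraMap_mem_of_finite 𝔭.1 c⁻¹)
  rwa [map_inv₀, map_inv₀, inv_le_one₀ (by simpa [zero_lt_iff])] at h

/-- Hensel's lemma for squares: a unit of the valuation ring whose residue is a square is a square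
in the completion. -/
theorem Place.isLocalSquare_of_isSquare_residue (h2 : 𝔭.maxIdeal.valuation K 2 = 1)
    (f : Kˣ) (a : 𝔭.1) (ha : (a : K) = f) (hf : 𝔭.ord f = 0)
    (hres : IsSquare (IsLocalRing.residue 𝔭.1 a)) : 𝔭.IsLocalSquare f := by
  obtain ⟨r, hr⟩ := hres
  obtain ⟨b, rfl⟩ := IsLocalRing.residue_surjective r
  have hmem : a - b * b ∈ IsLocalRing.maximalIdeal 𝔭.1 := by
    rw [← IsLocalRing.residue_eq_zero_iff, map_sub, map_mul, hr, sub_self]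
  have hlt : 𝔭.maxIdeal.valuation K ((a : K) - b * b) < 1 :=
    (𝔭.maxIdeal.valuation_lt_one_iff_mem (K := K) (a - b * b)).mpr hmem
  have ha1 : 𝔭.maxIdeal.valuation K (a : K) = 1 := by
    rw [ha, 𝔭.valuation_eq_exp, hf, neg_zero, exp_zero]
  have hb1 : 𝔭.maxIdeal.valuation K ((b : K) * b) = 1 := by
    rw [← ha1]
    refine (Valuation.map_eq_of_sub_lt _ ?_)
    rwa [ha1, Valuation.map_sub_swap]
  have hb0 : (b : K) ≠ 0 := by
    intro h
    simp [h] at hb1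
  have hv : ∀ x : K, Valued.v (algebraMap K 𝔭.completion x) = 𝔭.maxIdeal.valuation K x :=
    fun x => HeightOneSpectrum.valuedAdicCompletion_eq_valuation' 𝔭.maxIdeal x
  have hsq := isSquare_one_add_of_valued_lt_one (L := 𝔭.completion)
    (c := algebraMap K 𝔭.completion (((a : K) - b * b) / (b * b)))
    (by rw [← map_ofNat (algebraMap K 𝔭.completion) 2, hv, h2])
    (by rwa [hv, map_div₀, hb1, div_one])
  -- A square times a principal unit.
  have hfac : (f : K) = b * b * (1 + ((a : K) - b * b) / (b * b)) := by
    rw [← ha]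
    field_simp
    ring
  rw [Place.IsLocalSquare, hfac, map_mul, map_add, map_one]
  exact (IsSquare.map (algebraMap K 𝔭.completion) ⟨(b : K), rfl⟩).mul hsq

/-- At a place of a function field over a finite field of odd characteristic, a product of two
local non-squares of even valuation is a local square. -/
theorem Place.isLocalSquare_mul [Finite F] [Algebra F K] (h2 : (2 : F) ≠ 0)
    (htr : Algebra.trdeg F K = 1) {f g : Kˣ} (hf : Even (𝔭.ord f)) (hg : Even (𝔭.ord g))
    (hfs : ¬ 𝔭.IsLocalSquare f) (hgs : ¬ 𝔭.IsLocalSquare g) : 𝔭.IsLocalSquare (f * g) := by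
  -- Even order can be removed by a square factor, which reduces the claim to units and their
  -- residues.
  have hnorm : ∀ f : Kˣ, Even (𝔭.ord f) → ∃ u : Kˣ, 𝔭.ord (f * (u * u)) = 0 := by
    rintro f ⟨k, hk⟩
    obtain ⟨u, hu⟩ := 𝔭.exists_ord_eq (-k)
    exact ⟨u, by rw [𝔭.ord_mul, 𝔭.ord_mul, hk, hu]; ring⟩
  have hinv : ∀ f u : Kˣ, 𝔭.IsLocalSquare (f * (u * u)) ↔ 𝔭.IsLocalSquare f := by
    intro f u
    rw [← 𝔭.legendre_eq_one_iff, ← 𝔭.legendre_eq_one_iff, 𝔭.legendre_mul_self]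
  obtain ⟨u, hu⟩ := hnorm f hf
  obtain ⟨w, hw⟩ := hnorm g hg
  rw [← hinv _ u] at hfs
  rw [← hinv _ w] at hgs
  rw [← hinv _ (u * w), show f * g * (u * w * (u * w)) = f * (u * u) * (g * (w * w)) by
    simp only [mul_left_comm, mul_comm]]
  generalize f * (u * u) = x at *
  generalize g * (w * w) = y at *
  have hlift : ∀ x : Kˣ, 𝔭.ord x = 0 → (x : K) ∈ 𝔭.1 := fun x hx => by
    rw [← 𝔭.valuation_le_one_iff, 𝔭.valuation_eq_exp, hx, neg_zero, exp_zero]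
  have h2v : 𝔭.maxIdeal.valuation K 2 = 1 := by
    have := 𝔭.valuation_algebraMap_of_finite h2
    rwa [map_ofNat] at this
  let _ : Algebra F 𝔭.1 := ((algebraMap F K).codRestrict 𝔭.1.toSubring
    (algebraMap_mem_of_finite 𝔭.1)).toAlgebra
  have : IsScalarTower F 𝔭.1 K := .of_algebraMap_eq fun _ => rfl
  have := isAlgebraic_residue htr 𝔭.1 𝔭.ne_top
  refine 𝔭.isLocalSquare_of_isSquare_residue h2v (x * y) (⟨x, hlift x hu⟩ * ⟨y, hlift y hw⟩) rfl
    (by rw [𝔭.ord_mul, hu, hw, add_zero]) ?_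
  rw [map_mul]
  exact isSquare_mul_of_not_isSquare (F := F)
    (fun h => hfs (𝔭.isLocalSquare_of_isSquare_residue h2v x _ rfl hu h))
    (fun h => hgs (𝔭.isLocalSquare_of_isSquare_residue h2v y _ rfl hw h))

end LocalSquares

end SSingular
end

/-! ### Finiteness of zeros and existence of divisors -/

noncomputable section

namespace SSingular

open WithZero IsDedekindDomain IntermediateField IntermediateField.algebraAdjoinAdjoin

section FinitelyManyZeros

variable {F K : Type*} [Field F] [Field K]

/-- Weak approximation at finitely many places. -/
theorem exists_valuation_eq_one_and_lt_one {ι : Type*} [Finite ι] {p : ι → Place K}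
    (hp : Function.Injective p) (i : ι) : ∃ z : K, (p i).maxIdeal.valuation K z = 1 ∧
      ∀ j ≠ i, (p j).maxIdeal.valuation K z < 1 := by
  have hb : (1 : NNReal) < 2 := one_lt_two
  let w : ι → AbsoluteValue K ℝ := fun j => (p j).maxIdeal.adicAbv hb
  have hw_lt : ∀ j x, w j x < 1 ↔ (p j).maxIdeal.valuation K x < 1 := fun j x => by
    change ((WithZeroMulInt.toNNReal (ne_zero_of_lt hb) _ : NNReal) : ℝ) < 1 ↔ _
    rw [← WithZeroMulInt.toNNReal_lt_one_iff hb]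
    norm_cast
  have hw_le : ∀ j x, w j x ≤ 1 ↔ (p j).maxIdeal.valuation K x ≤ 1 := fun j x => by
    change ((WithZeroMulInt.toNNReal (ne_zero_of_lt hb) _ : NNReal) : ℝ) ≤ 1 ↔ _
    rw [← WithZeroMulInt.toNNReal_le_one_iff hb]
    norm_cast
  have hnontriv : ∀ j, (w j).IsNontrivial := fun j => by
    obtain ⟨f, hf⟩ := (p j).exists_ord_eq 1
    refine ⟨f, f.ne_zero, ((hw_lt j f).mpr ?_).ne⟩
    rw [(p j).valuation_eq_exp, hf, ← exp_zero, exp_lt_exp]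
    norm_num
  have hequiv : Pairwise fun j k => ¬ (w j).IsEquiv (w k) := fun j k hjk h => by
    refine hjk (hp (Subtype.ext (ValuationSubring.ext _ _ fun x => ?_)))
    rw [← (p j).valuation_le_one_iff, ← (p k).valuation_le_one_iff, ← hw_le, ← hw_le,
      h.le_one_iff]
  obtain ⟨a, ha, ha'⟩ := AbsoluteValue.exists_one_lt_lt_one_pi_of_not_isEquiv hnontriv hequiv i
  have ha1 : 1 < (p i).maxIdeal.valuation K a := by
    rw [← not_le, ← hw_le, not_le]
    exact ha
  -- Where a is large, 1 + a has the valuation of a; where a is small, 1 + a is a unit.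
  refine ⟨a / (1 + a), ?_, fun j hj => ?_⟩
  · rw [map_div₀, Valuation.map_add_eq_of_lt_right _ (by rwa [map_one]), div_self]
    exact (zero_lt_one.trans ha1).ne'
  · have h1 : (p j).maxIdeal.valuation K a < 1 := (hw_lt j a).mp (ha' j hj)
    rwa [map_div₀, Valuation.map_add_eq_of_lt_left _ (by rwa [map_one]), map_one, div_one]

variable [Finite F] [Algebra F K]

theorem Place.valuation_aeval_le_one (𝔭 : Place K) {f : K} (hf : f ∈ 𝔭.1) (P : Polynomial F) :
    𝔭.maxIdeal.valuation K (Polynomial.aeval f P) ≤ 1 := by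
  rw [𝔭.valuation_le_one_iff, Polynomial.aeval_eq_sum_range]
  refine sum_mem fun i _ => ?_
  rw [Algebra.smul_def]
  exact mul_mem (algebraMap_mem_of_finite _ _) (pow_mem hf _)

/-- The constant term is a nonzero constant, hence a unit, and dominates the remaining multiple of
f. -/
theorem Place.valuation_aeval_eq_one (𝔭 : Place K) {f : K} (hf : 𝔭.maxIdeal.valuation K f < 1)
    {P : Polynomial F} (hP : ¬ Polynomial.X ∣ P) :
    𝔭.maxIdeal.valuation K (Polynomial.aeval f P) = 1 := by
  have hfA : f ∈ 𝔭.1 := (𝔭.valuation_le_one_iff f).mp hf.le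
  have h1 : 𝔭.maxIdeal.valuation K (algebraMap F K (P.coeff 0)) = 1 :=
    𝔭.valuation_algebraMap_of_finite fun h => hP (Polynomial.X_dvd_iff.mpr h)
  rw [← Polynomial.divX_mul_X_add P, map_add, map_mul, Polynomial.aeval_X, Polynomial.aeval_C,
    Valuation.map_add_eq_of_lt_right, h1]
  rw [h1, map_mul]
  exact (mul_le_of_le_one_left' (𝔭.valuation_aeval_le_one hfA _)).trans_lt hf

/-- Elements separating finitely many zeros of `f` are linearly independent over `F(f)`. -/
theorem linearIndependent_of_separating {ι : Type*} [Fintype ι] {p : ι → Place K} {f : K}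
    (hf : ∀ i, (p i).maxIdeal.valuation K f < 1) {z : ι → K}
    (hz : ∀ i, (p i).maxIdeal.valuation K (z i) = 1)
    (hz' : ∀ i j, i ≠ j → (p i).maxIdeal.valuation K (z j) < 1) :
    LinearIndependent F⟮f⟯ z := by
  classical
  rw [← LinearIndependent.iff_fractionRing (Algebra.adjoin F {f}), Fintype.linearIndependent_iff]
  intro g hg
  by_contra! hne
  obtain ⟨i₀, hi₀⟩ := hne
  have hpoly : ∀ i, ∃ P : Polynomial F, Polynomial.aeval f P = (g i : K) := fun i => by
    have h : (g i : K) ∈ (Polynomial.aeval (R := F) f).range :=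
      Algebra.adjoin_singleton_eq_range_aeval F f ▸ (g i).2
    exact h
  choose P hP using hpoly
  -- Dividing a relation over F[f] by the gcd leaves some coefficient prime to X. At the
  -- corresponding zero of f that term has valuation 1 and all others less, so the sum cannot
  -- vanish.
  let _ : NormalizedGCDMonoid (Polynomial F) :=
    Classical.choice inferInstance
  obtain ⟨Q, hQ, hQ1⟩ := Finset.extract_gcd P (s := Finset.univ) ⟨i₀, Finset.mem_univ _⟩
  set d := Finset.univ.gcd P
  have hd : Polynomial.aeval f d ≠ 0 := by
    intro h
    apply hi₀
    rw [← Subtype.coe_inj, ← hP, hQ i₀ (Finset.mem_univ _), map_mul, h, zero_mul]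
    rfl
  have hsum : ∑ i, Polynomial.aeval f (Q i) * z i = 0 := by
    refine (mul_eq_zero.mp ?_).resolve_left hd
    rw [Finset.mul_sum, ← hg]
    refine Finset.sum_congr rfl fun i _ => ?_
    rw [Algebra.smul_def, ← mul_assoc, ← map_mul, ← hQ i (Finset.mem_univ _), hP]
    rfl
  have hX : ∃ i, ¬ Polynomial.X ∣ Q i := by
    by_contra! h
    have := Finset.dvd_gcd (s := Finset.univ) (f := Q) fun i _ => h i
    rw [hQ1] at this
    exact Polynomial.not_isUnit_X (isUnit_of_dvd_one this)
  obtain ⟨i, hi⟩ := hX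
  rw [← Finset.add_sum_erase _ _ (Finset.mem_univ i)] at hsum
  have h1 : (p i).maxIdeal.valuation K (Polynomial.aeval f (Q i) * z i) = 1 := by
    rw [map_mul, (p i).valuation_aeval_eq_one (hf i) hi, hz, one_mul]
  rw [eq_neg_of_add_eq_zero_left hsum, Valuation.map_neg] at h1
  refine (Valuation.map_sum_lt _ one_ne_zero fun j hj => ?_).ne h1
  rw [map_mul]
  exact (mul_le_of_le_one_left' ((p i).valuation_aeval_le_one
    (((p i).valuation_le_one_iff f).mp (hf i).le) _)).trans_lt
    (hz' i j (Finset.ne_of_mem_erase hj).symm)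

theorem finite_setOf_ord_pos [Algebra.EssFiniteType F K] (htr : Algebra.trdeg F K = 1) (f : Kˣ) :
    {𝔭 : Place K | 0 < 𝔭.ord f}.Finite := by
  by_cases hf : Transcendental F (f : K)
  · have := finiteDimensional_adjoin_of_transcendental htr hf
    by_contra hinf
    obtain ⟨T, hT, hcard⟩ := Set.Infinite.exists_subset_card_eq hinf (Module.finrank F⟮(f : K)⟯ K + 1)
    choose z hz hz' using exists_valuation_eq_one_and_lt_one (p := fun x : T => x.1)
      Subtype.val_injective
    have hlin := linearIndependent_of_separating (F := F) (p := fun x : T => x.1) (f := f) (z := z)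
      (fun i => by
        rw [Place.valuation_eq_exp, ← exp_zero, exp_lt_exp]
        have : 0 < i.1.ord f := hT i.2
        omega) hz (fun i j hij => hz' j i hij)
    have := hlin.fintype_card_le_finrank
    rw [Fintype.card_coe] at this
    omega
  -- An algebraic f lies in a finite subfield, so it is a unit at every place.
  · have hint : IsAlgebraic F (f : K) := not_not.mp hf
    have : FiniteDimensional F F⟮(f : K)⟯ := adjoin.finiteDimensional hint.isIntegral
    have : Finite F⟮(f : K)⟯ := Module.finite_of_finite F
    convert Set.finite_empty
    refine Set.eq_empty_of_forall_notMem fun 𝔭 (h𝔭 : 0 < 𝔭.ord f) => ?_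
    have h1 := 𝔭.valuation_algebraMap_of_finite (F := F⟮(f : K)⟯)
      (c := ⟨f, mem_adjoin_simple_self F (f : K)⟩) (fun h => f.ne_zero (congrArg Subtype.val h))
    change 𝔭.maxIdeal.valuation K (f : K) = 1 at h1
    rw [𝔭.valuation_eq_exp, ← exp_zero, exp_inj] at h1
    omega

/-- Every nonzero function has a divisor. -/
theorem exists_divisor [Algebra.EssFiniteType F K] (htr : Algebra.trdeg F K = 1) (f : Kˣ) :
    ∃ D : Divisor K, ∀ 𝔭 : Place K, D 𝔭 = 𝔭.ord f := by
  have hfin : {𝔭 : Place K | 𝔭.ord f ≠ 0}.Finite := by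
    refine ((finite_setOf_ord_pos htr f).union (finite_setOf_ord_pos htr f⁻¹)).subset ?_
    intro 𝔭 (h : 𝔭.ord f ≠ 0)
    have := 𝔭.ord_inv f
    rcases lt_or_gt_of_ne h with h | h
    · exact Or.inr (show 0 < 𝔭.ord f⁻¹ by omega)
    · exact Or.inl h
  exact ⟨Finsupp.ofSupportFinite (fun 𝔭 => 𝔭.ord f) hfin, fun 𝔭 => rfl⟩

end FinitelyManyZeros

end SSingular
end

/-! ### Parities of valuations and divisor classes modulo 2 -/

noncomputable section

namespace SSingular

section Parity

variable {K : Type*} [Field K]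

theorem sqClass_surjective : Function.Surjective (sqClass : Kˣ → SquareClass K) :=
  fun x => (QuotientAddGroup.mk'_surjective _ x).imp fun _ h => h

/-- The parity of the valuation at a place, as a linear functional on square classes. -/
def Place.parity (𝔭 : Place K) : SquareClass K →ₗ[ZMod 2] ZMod 2 :=
  AddMonoidHom.toZModLinearMap 2 <| QuotientAddGroup.lift _
    ((Int.castAddHom (ZMod 2)).comp (AddMonoidHom.mk' (fun f : Additive Kˣ => 𝔭.ord f.toMul)
      fun f g => 𝔭.ord_mul f.toMul g.toMul)) (by
    rintro _ ⟨f, rfl⟩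
    simp only [zsmulAddGroupHom_apply, map_zsmul, AddMonoidHom.mem_ker]
    rw [two_zsmul, CharTwo.add_self_eq_zero])

theorem Place.parity_sqClass (𝔭 : Place K) (f : Kˣ) :
    𝔭.parity (sqClass f) = (𝔭.ord f : ZMod 2) := rfl

theorem Place.parity_sqClass_eq_zero_iff (𝔭 : Place K) (f : Kˣ) :
    𝔭.parity (sqClass f) = 0 ↔ Even (𝔭.ord f) := by
  rw [𝔭.parity_sqClass, ZMod.intCast_zmod_eq_zero_iff_dvd, even_iff_two_dvd]
  rfl

theorem mem_Sing_iff_parity {𝔖 : Set (Place K)} {x : SquareClass K} :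
    x ∈ Sing 𝔖 ↔ ∀ 𝔭 ∉ 𝔖, 𝔭.parity x = 0 := by
  obtain ⟨f, rfl⟩ := sqClass_surjective x
  simp only [Place.parity_sqClass_eq_zero_iff]
  constructor
  · intro h 𝔭 h𝔭
    obtain ⟨g, hg, hgf⟩ := mem_Sing.mp h
    rw [← 𝔭.parity_sqClass_eq_zero_iff, ← hgf, 𝔭.parity_sqClass_eq_zero_iff]
    exact hg 𝔭 h𝔭
  · exact fun h => mem_Sing.mpr ⟨f, h, rfl⟩

theorem sqClass_mem_Sing_iff {𝔖 : Set (Place K)} {f : Kˣ} : sqClass f ∈ Sing 𝔖 ↔ IsSingular 𝔖 f := by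
  simp only [mem_Sing_iff_parity, Place.parity_sqClass_eq_zero_iff]
  rfl

theorem Sing_mono {𝔖 𝔗 : Set (Place K)} (h : 𝔖 ⊆ 𝔗) : Sing 𝔖 ≤ Sing 𝔗 := fun x hx => by
  rw [mem_Sing_iff_parity] at hx ⊢
  exact fun 𝔭 h𝔭 => hx 𝔭 fun h' => h𝔭 (h h')

/-- The class of a divisor in `Pic / 2 Pic`. -/
def divisorClass : Divisor K →+ ModTwo (Pic K) :=
  ModTwo.mk.comp (QuotientAddGroup.mk' (principalDivisors K))

/-- Both sides are additive in D and agree on prime divisors. Relations in Pic/2Pic thus become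
𝔽₂-relations between places. -/
theorem divisorClass_eq_linearCombination (D : Divisor K) :
    divisorClass D = Finsupp.linearCombination (ZMod 2) Place.picClass
      (Finsupp.mapRange.addMonoidHom (Int.castAddHom (ZMod 2)) D) := by
  suffices h : (divisorClass : Divisor K →+ _) =
      (Finsupp.linearCombination (ZMod 2) Place.picClass).toAddMonoidHom.comp
        (Finsupp.mapRange.addMonoidHom (Int.castAddHom (ZMod 2))) from DFunLike.congr_fun h D
  ext 𝔭
  simp [divisorClass, Place.picClass]

theorem divisorClass_eq_zero_iff (D : Divisor K) :
    divisorClass D = 0 ↔ ∃ E : Divisor K, ∃ f : Kˣ, ∀ 𝔭, D 𝔭 = 𝔭.ord f + 2 * E 𝔭 := by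
  have h1 : divisorClass D = 0 ↔ ∃ E : Divisor K, D - (2 : ℤ) • E ∈ principalDivisors K := by
    constructor
    · intro h
      obtain ⟨e, he⟩ := (QuotientAddGroup.eq_zero_iff _).mp h
      obtain ⟨E, rfl⟩ := QuotientAddGroup.mk'_surjective _ e
      refine ⟨E, (QuotientAddGroup.eq_zero_iff _).mp ?_⟩
      change QuotientAddGroup.mk' (principalDivisors K) (D - (2 : ℤ) • E) = 0
      rw [map_sub, map_zsmul, sub_eq_zero]
      exact he.symm
    · rintro ⟨E, hE⟩
      refine (QuotientAddGroup.eq_zero_iff _).mpr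
        ⟨QuotientAddGroup.mk' (principalDivisors K) E, ?_⟩
      rw [zsmulAddGroupHom_apply, ← map_zsmul, eq_comm, ← sub_eq_zero, ← map_sub]
      exact (QuotientAddGroup.eq_zero_iff _).mpr hE
  rw [h1]
  refine exists_congr fun E => exists_congr fun f => forall_congr' fun 𝔭 => ?_
  simp [sub_eq_iff_eq_add]

end Parity

/-! ### Construction of the λ's and the basis of `Sing 𝔖` -/

section Main

variable {F K : Type*} [Field F] [Finite F] [Field K] [Algebra F K]

/-- If the places of `𝔖'` are independent in `Pic / 2 Pic`, then `𝔖'`-singular elements are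
singular. -/
theorem Sing_le_Sing_empty [Algebra.EssFiniteType F K] (htr : Algebra.trdeg F K = 1)
    {𝔖' : Set (Place K)} (h : LinearIndepOn (ZMod 2) Place.picClass 𝔖') :
    Sing 𝔖' ≤ Sing (∅ : Set (Place K)) := by
  intro x hx
  obtain ⟨f, rfl⟩ := sqClass_surjective x
  rw [mem_Sing_iff_parity] at hx ⊢
  obtain ⟨D, hD⟩ := exists_divisor htr f
  have h0 : divisorClass D = 0 := (divisorClass_eq_zero_iff D).mpr ⟨0, f, by simpa using hD⟩
  rw [divisorClass_eq_linearCombination] at h0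
  have hl := linearIndepOn_iff.mp h _ (by
    rw [Finsupp.mem_supported']
    intro 𝔭 h𝔭
    simpa [hD, Place.parity_sqClass] using hx 𝔭 h𝔭) h0
  intro 𝔭 _
  simpa [hD, Place.parity_sqClass] using DFunLike.congr_fun hl 𝔭

/-- A place outside a maximal independent set `𝔖'` is, modulo `2`, equivalent to a combination of
places of `𝔖'`. -/
theorem exists_isSingular_odd {𝔖' 𝔖 : Set (Place K)} (h : IsMaximalIndependent 𝔖' 𝔖)
    {𝔭 : Place K} (h𝔭 : 𝔭 ∈ 𝔖 \ 𝔖') : ∃ f : Kˣ, IsSingular (𝔖' ∪ {𝔭}) f ∧ Odd (𝔭.ord f) := by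
  have hind : LinearIndepOn (ZMod 2) Place.picClass 𝔖' := h.prop.2
  have hspan : 𝔭.picClass ∈ Submodule.span (ZMod 2) (Place.picClass '' 𝔖') := by
    by_contra hn
    have hins : LinearIndepOn (ZMod 2) Place.picClass (insert 𝔭 𝔖') := hind.insert hn
    exact h𝔭.2 (h.le_of_ge ⟨Set.insert_subset h𝔭.1 h.prop.1, hins⟩ (Set.subset_insert _ _)
      (Set.mem_insert _ _))
  obtain ⟨l, hl, hl'⟩ := (Finsupp.mem_span_image_iff_linearCombination _).mp hspan
  rw [Finsupp.mem_supported'] at hl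
  let m : Place K →₀ ZMod 2 := l - Finsupp.single 𝔭 1
  -- Any integral lift of m would do, since only parities matter.
  let D : Divisor K := m.mapRange (fun a => (a.val : ℤ)) (by simp)
  have hDm : Finsupp.mapRange.addMonoidHom (Int.castAddHom (ZMod 2)) D = m := by
    ext 𝔮
    simp [D]
  have h0 : divisorClass D = 0 := by
    rw [divisorClass_eq_linearCombination, hDm, map_sub, hl', Finsupp.linearCombination_single,
      one_smul, sub_self]
  obtain ⟨E, f, hf⟩ := (divisorClass_eq_zero_iff D).mp h0
  have hpar : ∀ 𝔮 : Place K, 𝔮.parity (sqClass f) = m 𝔮 := by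
    intro 𝔮
    rw [← hDm, 𝔮.parity_sqClass, Finsupp.mapRange.addMonoidHom_apply, Finsupp.mapRange_apply, hf]
    simp [show (2 : ZMod 2) = 0 from rfl]
  refine ⟨f, fun 𝔮 h𝔮 => ?_, ?_⟩
  · rw [Set.mem_union, not_or, Set.mem_singleton_iff] at h𝔮
    rw [← 𝔮.parity_sqClass_eq_zero_iff, hpar]
    simp [m, hl 𝔮 h𝔮.1, Ne.symm h𝔮.2]
  · rw [← Int.not_even_iff_odd, ← 𝔭.parity_sqClass_eq_zero_iff, hpar]
    simp [m, hl 𝔭 h𝔭.2]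

theorem Place.IsLocalSquare.mul {𝔭 : Place K} {f g : Kˣ} (hf : 𝔭.IsLocalSquare f)
    (hg : 𝔭.IsLocalSquare g) : 𝔭.IsLocalSquare (f * g) := by
  rw [Place.IsLocalSquare, Units.val_mul, map_mul]
  exact IsSquare.mul hf hg

theorem Place.isLocalSquare_one (𝔭 : Place K) : 𝔭.IsLocalSquare 1 := by
  simp [Place.IsLocalSquare]

theorem exists_isLambda (h2 : (2 : F) ≠ 0) (htr : Algebra.trdeg F K = 1) {n : ℕ}
    {β : Fin n → SquareClass K} {𝔟 : Fin n → Place K}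
    (hβ : ∀ i, β i ∈ Sing (∅ : Set (Place K))) (hcompat : Compatible β 𝔟)
    {𝔖 𝔖' : Set (Place K)} (hdisj : Disjoint 𝔖 (Set.range 𝔟))
    (h𝔖' : IsMaximalIndependent 𝔖' 𝔖) {𝔭 : Place K} (h𝔭 : 𝔭 ∈ 𝔖 \ 𝔖') :
    ∃ f : Kˣ, IsLambda 𝔟 𝔖' 𝔭 f := by
  classical
  obtain ⟨f, hf, hodd⟩ := exists_isSingular_odd h𝔖' h𝔭
  choose b hb using fun i => sqClass_surjective (β i)
  have hbsing : ∀ i, IsSingular ∅ (b i) := fun i => by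
    rw [← sqClass_mem_Sing_iff, hb]
    exact hβ i
  have hleg : ∀ i j, (𝔟 j).legendre (b i) = if i = j then -1 else 1 := fun i j => by
    rw [← (𝔟 j).legendreClass_sqClass, hb, hcompat]
  -- The correction multiplies f by βᵢ exactly when f fails to be a square at 𝔟ᵢ.
  let c : Fin n → Kˣ := fun i => if (𝔟 i).IsLocalSquare f then 1 else b i
  have hc : ∏ i, c i ∈ singularSubgroup (∅ : Set (Place K)) := by
    refine prod_mem fun i _ => ?_
    dsimp only [c]
    split_ifs
    · exact one_mem _
    · exact hbsing i
  have hceven : ∀ 𝔮 : Place K, Even (𝔮.ord (∏ i, c i)) := fun 𝔮 => hc 𝔮 (Set.notMem_empty _)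
  refine ⟨f * ∏ i, c i, fun 𝔮 h𝔮 => ?_, ?_, fun j => ?_⟩
  · rw [𝔮.ord_mul]
    exact (hf 𝔮 h𝔮).add (hceven 𝔮)
  · rw [𝔭.ord_mul]
    exact hodd.add_even (hceven 𝔭)
  · rw [Place.legendre_eq_one_iff, ← Finset.mul_prod_erase _ _ (Finset.mem_univ j), ← mul_assoc]
    have hj : 𝔟 j ∉ 𝔖' ∪ {𝔭} := by
      intro h
      refine Set.disjoint_left.mp hdisj ?_ (Set.mem_range_self j)
      rcases h with h | h
      · exact h𝔖'.prop.1 h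
      · exact h ▸ h𝔭.1
    refine Place.IsLocalSquare.mul ?_ ?_
    · dsimp only [c]
      split_ifs with hs
      · rwa [mul_one]
      · exact (𝔟 j).isLocalSquare_mul h2 htr (hf _ hj) (hbsing j _ (Set.notMem_empty _)) hs
          (((𝔟 j).legendre_eq_neg_one_iff _).mp (by rw [hleg, if_pos rfl])).1
    · refine Finset.prod_induction _ (𝔟 j).IsLocalSquare (fun _ _ => .mul) (𝔟 j).isLocalSquare_one ?_
      intro i hi
      dsimp only [c]
      split_ifs
      · exact (𝔟 j).isLocalSquare_one
      · rw [← Place.legendre_eq_one_iff, hleg, if_neg (Finset.ne_of_mem_erase hi)]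

theorem isBasisOf_sumElim [Algebra.EssFiniteType F K] (htr : Algebra.trdeg F K = 1) {n : ℕ}
    {β : Fin n → SquareClass K} {𝔟 : Fin n → Place K}
    (hβ : IsBasisOf β (Sing (∅ : Set (Place K)))) {𝔖 𝔖' : Set (Place K)} (h𝔖fin : 𝔖.Finite)
    (h𝔖' : IsMaximalIndependent 𝔖' 𝔖) (lam : ↥(𝔖 \ 𝔖') → Kˣ)
    (hlam : ∀ 𝔭 : ↥(𝔖 \ 𝔖'), IsLambda 𝔟 𝔖' 𝔭 (lam 𝔭)) :
    IsBasisOf (Sum.elim β (fun 𝔭 => sqClass (lam 𝔭))) (Sing 𝔖) := by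
  classical
  have : Fintype ↥(𝔖 \ 𝔖') := (h𝔖fin.subset Set.sdiff_subset).fintype
  have hpar : ∀ 𝔭 𝔮 : ↥(𝔖 \ 𝔖'), (𝔮 : Place K).parity (sqClass (lam 𝔭)) =
      if 𝔭 = 𝔮 then 1 else 0 := by
    intro 𝔭 𝔮
    split_ifs with h
    · subst h
      obtain ⟨k, hk⟩ := (hlam 𝔭).2.1
      rw [Place.parity_sqClass, hk]
      simp [show (2 : ZMod 2) = 0 from rfl]
    · rw [Place.parity_sqClass_eq_zero_iff]
      refine (hlam 𝔭).1 𝔮 ?_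
      rintro (h' | h')
      · exact 𝔮.2.2 h'
      · exact h (Subtype.ext h').symm
  have hβmem : ∀ i, β i ∈ Sing (∅ : Set (Place K)) := fun i =>
    hβ.2 ▸ Submodule.subset_span (Set.mem_range_self i)
  refine ⟨?_, le_antisymm ?_ ?_⟩
  · let Φ : SquareClass K →ₗ[ZMod 2] (↥(𝔖 \ 𝔖') → ZMod 2) := LinearMap.pi fun 𝔮 => 𝔮.1.parity
    have hΦ : Sing (∅ : Set (Place K)) ≤ LinearMap.ker Φ := fun x hx => by
      rw [LinearMap.mem_ker]
      ext 𝔮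
      exact mem_Sing_iff_parity.mp hx 𝔮.1 (Set.notMem_empty _)
    -- It remains to see that the λ's are independent modulo `Sing ∅`; the map induced by Φ on that
    -- quotient sends them to the standard basis.
    have hβ' : LinearIndependent (ZMod 2) fun i => (⟨β i, hβmem i⟩ : Sing (∅ : Set (Place K))) :=
      LinearIndependent.of_comp (Sing (∅ : Set (Place K))).subtype hβ.1
    refine hβ'.sumElim_of_quotient _ ?_
    refine LinearIndependent.of_comp ((Sing (∅ : Set (Place K))).liftQ Φ hΦ) ?_
    convert! (Pi.basisFun (ZMod 2) ↥(𝔖 \ 𝔖')).linearIndependent with 𝔭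
    ext 𝔮
    simp [Φ, hpar, Pi.single_apply, eq_comm]
  · rw [Submodule.span_le]
    rintro _ ⟨i | 𝔭, rfl⟩
    · exact Sing_mono (Set.empty_subset 𝔖) (hβmem i)
    · refine Sing_mono (Set.union_subset h𝔖'.prop.1 (Set.singleton_subset_iff.mpr 𝔭.2.1)) ?_
      exact sqClass_mem_Sing_iff.mpr (hlam 𝔭).1
  · intro x hx
    rw [Set.Sum.elim_range, Submodule.span_union, hβ.2]
    -- By duality s has the same parities as x on `𝔖 \ 𝔖'`.
    let s := ∑ 𝔭 : ↥(𝔖 \ 𝔖'), 𝔭.1.parity x • sqClass (lam 𝔭)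
    have hs : s ∈ Submodule.span (ZMod 2) (Set.range fun 𝔭 => sqClass (lam 𝔭)) :=
      sum_mem fun 𝔭 _ => Submodule.smul_mem _ _ (Submodule.subset_span (Set.mem_range_self 𝔭))
    have hxs : x - s ∈ Sing 𝔖' := by
      rw [mem_Sing_iff_parity] at hx ⊢
      intro 𝔮 h𝔮
      rw [map_sub, map_sum, sub_eq_zero]
      simp only [map_smul, smul_eq_mul]
      by_cases h : 𝔮 ∈ 𝔖
      · have h' := fun 𝔭 => hpar 𝔭 ⟨𝔮, h, h𝔮⟩
        simp only at h'
        simp [h']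
      · rw [hx 𝔮 h, eq_comm]
        refine Finset.sum_eq_zero fun 𝔭 _ => ?_
        rw [(𝔮.parity_sqClass_eq_zero_iff _).mpr, mul_zero]
        refine (hlam 𝔭).1 𝔮 ?_
        rintro (h' | h')
        · exact h𝔮 h'
        · exact h (h' ▸ 𝔭.2.1)
    rw [← sub_add_cancel x s]
    exact Submodule.add_mem_sup (Sing_le_Sing_empty htr h𝔖'.prop.2 hxs) hs

end Main

end SSingular
end

open SSingular
theorem mainTheorem1 {F K : Type*} [Field F] [Finite F] [Field K] [Algebra (RatFunc F) K]
    [FunctionField F K] (hchar : ringChar F ≠ 2)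
    {n : ℕ} (β : Fin n → SquareClass K) (𝔟 : Fin n → Place K)
    (hβ : IsBasisOf β (Sing (∅ : Set (Place K)))) (hcompat : Compatible β 𝔟)
    (𝔖 𝔖' : Set (Place K)) (h𝔖fin : 𝔖.Finite) (hdisj : Disjoint 𝔖 (Set.range 𝔟))
    (h𝔖' : IsMaximalIndependent 𝔖' 𝔖) :
    (∀ 𝔭 ∈ 𝔖 \ 𝔖', ∃ f : Kˣ, IsLambda 𝔟 𝔖' 𝔭 f) ∧
    (∀ lam : ↥(𝔖 \ 𝔖') → Kˣ, (∀ 𝔭 : ↥(𝔖 \ 𝔖'), IsLambda 𝔟 𝔖' 𝔭 (lam 𝔭)) →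
      IsBasisOf (Sum.elim β (fun 𝔭 => sqClass (lam 𝔭))) (Sing 𝔖)) := by
  let _ : Algebra F K := ((algebraMap (RatFunc F) K).comp (algebraMap F (RatFunc F))).toAlgebra
  have : IsScalarTower F (RatFunc F) K := .of_algebraMap_eq fun _ => rfl
  have htr : Algebra.trdeg F K = 1 := trdeg_eq_one_of_finite_ratFunc
  have : Algebra.EssFiniteType F K := essFiniteType_of_finite_ratFunc
  refine ⟨fun 𝔭 h𝔭 => ?_, fun lam hlam => isBasisOf_sumElim htr hβ h𝔖fin h𝔖' lam hlam⟩
  exact exists_isLambda (Ring.two_ne_zero hchar) htr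
    (fun i => hβ.2 ▸ Submodule.subset_span (Set.mem_range_self i)) hcompat hdisj h𝔖' h𝔭
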